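/- Let $\theta_0\in\mathbb R$, write $X(r,\theta)=(r\cos\theta,r\sin\theta)$, and let $r_1,r_2:[\theta_0,\infty)\to(0,\infty)$ be continuous functions such that $$r_2(\theta+2\pi)<r_1(\theta)<r_2(\theta)\ \text{ for all }\theta\ge\theta_0,\qquad \lim_{\theta\to\infty}r_1(\theta)=\lim_{\theta\to\infty}r_2(\theta)=r_*$$ for some number $r_*>0$. Put $$U=\{X(r,\theta):\theta>\theta_0,\ r_1(\theta)<r<r_2(\theta)\},\qquad \widetilde U=\{X(r,\theta):\theta\ge\theta_0,\ r_1(\theta)\le r\le r_2(\theta)\},$$ $$\gamma=\{X(r_i(\theta),\theta):\theta\ge\theta_0,\ i=1,2\},\qquad \mathcal S_\theta=\{X(r,\theta):r_1(\theta)\le r\le r_2(\theta)\}\quad(\theta\ge\theta_0).$$ Let $A=(a_{ij})$ be a function from $U$ to the real symmetric $2\times2$ matrices and let $b:U\to\mathbb R^2$. Assume that there are constants $c_0,M_1>0$ and $M_2\ge0$ with $$\xi^{\rm T}A(x)\xi\ge c_0|\xi|^2,\qquad \operatorname{Tr}A(x)\le M_1,\qquad |b(x)|\le M_2\qquad\text{for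 all }x\in U,\ \xi\in\mathbb R^2,$$ and define $Lu=-\sum_{i,j=1}^2a_{ij}\dfrac{\partial^2u}{\partial x_i\partial x_j}+b\cdot\nabla u$ for $u\in C^2(U)$. Write $u^+=\max\{0,u\}$. Then there are constants $C_*>0$ and $\nu>0$, independent of $u$, such that the following holds for every $u\in C^2(U)\cap C(\widetilde U)$. (i) If $Lu\le0$ in $U$ and $u\le0$ on $\gamma$, then exactly one of the following two alternatives holds. (a) One has $u^+(x)\le\max_{\mathcal S_{\theta_0}}u^+$ for all $x\in\widetilde U$, and $$\max_{\mathcal S_\theta}u^+\le C_*\Big(\max_{\mathcal S_{\theta_0}}u^+\Big)e^{-\nu(\theta-\theta_0)}\quad\text{for all }\theta\ge\theta_0.$$ (b) There are $C_1>0$ and $\bar\theta_1\ge\theta_0$, both depending on $u$, such that $$\max_{\mathcal S_\theta}u^+\ge C_1e^{\nu(\theta-\theta_0)}\quad\text{for all }\theta\ge\bar\theta_1.$$ (ii) If $Lu=0$ in $U$ and $u=0$ on $\gamma$, then exactly one of the following two alternatives holds. (a) One has $|u(x)|\le\max_{\mathcal S_{\theta_0}}|u|$ for all $x\in\widetilde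 U$, and $$\max_{\mathcal S_\theta}|u|\le C_*\Big(\max_{\mathcal S_{\theta_0}}|u|\Big)e^{-\nu(\theta-\theta_0)}\quad\text{for all }\theta\ge\theta_0.$$ (b) There are $C>0$ and $\bar\theta\ge\theta_0$, both depending on $u$, such that $$\max_{\mathcal S_\theta}|u|\ge Ce^{\nu(\theta-\theta_0)}\quad\text{for all }\theta\ge\bar\theta.$$ -/

import Mathlib

noncomputable section

namespace WindingDomain

/-- The plane `ℝ²` with the Euclidean norm. -/
abbrev Plane : Type := EuclideanSpace ℝ (Fin 2)

/-- Polar coordinates `X(r, θ) = (r cos θ, r sin θ)`. -/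
def polar (r θ : ℝ) : Plane := !₂[r * Real.cos θ, r * Real.sin θ]

/-- The domain `U = {X(r, θ) : θ > θ₀, r₁(θ) < r < r₂(θ)}`. -/
def domain (θ₀ : ℝ) (r₁ r₂ : ℝ → ℝ) : Set Plane :=
  {x | ∃ r θ : ℝ, θ₀ < θ ∧ r₁ θ < r ∧ r < r₂ θ ∧ x = polar r θ}

/-- The set `Ũ = {X(r, θ) : θ ≥ θ₀, r₁(θ) ≤ r ≤ r₂(θ)}`, which is `U` together with its lateral
boundary curves and its initial cross-section, but without the limit circle. -/
def extDomain (θ₀ : ℝ) (r₁ r₂ : ℝ → ℝ) : Set Plane :=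
  {x | ∃ r θ : ℝ, θ₀ ≤ θ ∧ r₁ θ ≤ r ∧ r ≤ r₂ θ ∧ x = polar r θ}

/-- The lateral boundary `γ = γ₁ ∪ γ₂`, where `γᵢ = {X(rᵢ(θ), θ) : θ ≥ θ₀}`. -/
def lateral (θ₀ : ℝ) (r₁ r₂ : ℝ → ℝ) : Set Plane :=
  {x | ∃ θ : ℝ, θ₀ ≤ θ ∧ x = polar (r₁ θ) θ} ∪ {x | ∃ θ : ℝ, θ₀ ≤ θ ∧ x = polar (r₂ θ) θ}

/-- The cross-section `S_θ = {X(r, θ) : r₁(θ) ≤ r ≤ r₂(θ)}`. -/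
def crossSection (r₁ r₂ : ℝ → ℝ) (θ : ℝ) : Set Plane :=
  {x | ∃ r : ℝ, r₁ θ ≤ r ∧ r ≤ r₂ θ ∧ x = polar r θ}

/-- The maximum of `f` over `S_θ`. It is attained when `f` is continuous on `S_θ ≠ ∅`, see
`isGreatest_crossMax`. -/
def crossMax (r₁ r₂ : ℝ → ℝ) (f : Plane → ℝ) (θ : ℝ) : ℝ :=
  sSup (f '' crossSection r₁ r₂ θ)

theorem isGreatest_crossMax {r₁ r₂ : ℝ → ℝ} {f : Plane → ℝ} {θ : ℝ} (hr : r₁ θ ≤ r₂ θ)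
    (hf : ContinuousOn f (crossSection r₁ r₂ θ)) :
    IsGreatest (f '' crossSection r₁ r₂ θ) (crossMax r₁ r₂ f θ) := by
  have hS : crossSection r₁ r₂ θ = (fun r => polar r θ) '' Set.Icc (r₁ θ) (r₂ θ) := by
    ext x
    constructor
    · rintro ⟨r, h1, h2, rfl⟩
      exact ⟨r, ⟨h1, h2⟩, rfl⟩
    · rintro ⟨r, ⟨h1, h2⟩, rfl⟩
      exact ⟨r, h1, h2, rfl⟩
  have hc : Continuous fun r => polar r θ := by
    unfold polar
    refine (PiLp.continuous_toLp 2 (fun _ : Fin 2 => ℝ)).comp (continuous_pi fun i => ?_)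
    fin_cases i <;> simp <;> fun_prop
  have hK : IsCompact (crossSection r₁ r₂ θ) := hS ▸ isCompact_Icc.image hc
  have hN : (crossSection r₁ r₂ θ).Nonempty := ⟨_, r₁ θ, le_rfl, hr, rfl⟩
  exact (hK.image_of_continuousOn hf).isGreatest_sSup (hN.image f)

/-- The partial derivative `∂u/∂xᵢ`. -/
def partialDeriv (i : Fin 2) (u : Plane → ℝ) (x : Plane) : ℝ :=
  fderiv ℝ u x (EuclideanSpace.single i 1)

/-- The operator `Lu = -∑ aᵢⱼ ∂²u/∂xᵢ∂xⱼ + b · ∇u`. -/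
def ellipticOp (A : Plane → Matrix (Fin 2) (Fin 2) ℝ) (b : Plane → Plane)
    (u : Plane → ℝ) (x : Plane) : ℝ :=
  -(∑ i, ∑ j, A x i j * partialDeriv i (partialDeriv j u) x) + ∑ i, b x i * partialDeriv i u x

/-- `A` is symmetric on `Ω`, `ξᵀ A(x) ξ ≥ c₀ |ξ|²` and `Tr A(x) ≤ M₁` on `Ω`, with constants
`c₀, M₁ > 0`. -/
def IsElliptic (Ω : Set Plane) (A : Plane → Matrix (Fin 2) (Fin 2) ℝ) : Prop :=
  (∀ x ∈ Ω, (A x).IsSymm) ∧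
  ∃ c₀ M₁ : ℝ, 0 < c₀ ∧ 0 < M₁ ∧
    (∀ x ∈ Ω, ∀ ξ : Plane, c₀ * ‖ξ‖ ^ 2 ≤ ∑ i, ∑ j, ξ i * A x i j * ξ j) ∧
    ∀ x ∈ Ω, (A x).trace ≤ M₁

/-- The drift `b` is bounded on `Ω`. -/
def IsBoundedDrift (Ω : Set Plane) (b : Plane → Plane) : Prop :=
  ∃ M₂ : ℝ, 0 ≤ M₂ ∧ ∀ x ∈ Ω, ‖b x‖ ≤ M₂

/-- `f` is at most its maximum over `S_{θ₀}` on all of `Ũ`, and its maxima over the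
cross-sections decay at least like `C e^{-ν(θ-θ₀)}` times the maximum over `S_{θ₀}`. -/
def Decays (θ₀ : ℝ) (r₁ r₂ : ℝ → ℝ) (C ν : ℝ) (f : Plane → ℝ) : Prop :=
  (∀ x ∈ extDomain θ₀ r₁ r₂, f x ≤ crossMax r₁ r₂ f θ₀) ∧
  ∀ θ : ℝ, θ₀ ≤ θ →
    crossMax r₁ r₂ f θ ≤ C * crossMax r₁ r₂ f θ₀ * Real.exp (-ν * (θ - θ₀))

/-- The maxima of `f` over the cross-sections eventually dominate a positive multiple of
`e^{ν(θ-θ₀)}`. -/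
def Grows (θ₀ : ℝ) (r₁ r₂ : ℝ → ℝ) (ν : ℝ) (f : Plane → ℝ) : Prop :=
  ∃ C₁ : ℝ, 0 < C₁ ∧ ∃ θ₁ : ℝ, θ₀ ≤ θ₁ ∧
    ∀ θ : ℝ, θ₁ ≤ θ → C₁ * Real.exp (ν * (θ - θ₀)) ≤ crossMax r₁ r₂ f θ

end WindingDomain

end

open Filter Topology

namespace WindingDomain

/-! The maximum principle is run in the strip `r₁ θ ≤ r ≤ r₂ θ` of the `(r, θ)`-plane, against
barriers `G(θ) (B - e^{kr})`. For large `k` the concavity in `r` beats the drift, and if `G` varies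
slowly (`|G'| ≤ νG`, `G'' ≤ ν²G`) the angular terms are too small to spoil this. Hence, when `Lu ≤
0`, the difference of `u` and the barrier has no interior local maximum
(`ellipticOp_pos_of_isLocalMax`). The argument is pointwise and uses no regularity of the
coefficients.

Between the cross-sections at `α` and `β`, taking for `G` a sum of exponentials decaying away from
the two ends gives `exists_twoSidedBound`. With `α = θ₀` and `m(θ)` the maximum over a
cross-section, it reads `m(θ) ≤ 2 (m(θ₀) e^{-ν(θ-θ₀)} + m(β) e^{-ν(β-θ)})` for every `β ≥ θ`. If at
a single `θ` the first term does not suffice, the second forces `m(β)` to grow like `e^{νβ}`;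
otherwise `m` decays (`TwoSidedBound.xor_decays_grows`). The two-sided equation follows by using
both `u` and `-u`. -/

/-- First- and second-order necessary conditions at a local maximum. -/
theorem second_order_of_isLocalMax {g g' : ℝ → ℝ} {g'' x : ℝ} (hmax : IsLocalMax g x)
    (h1 : ∀ᶠ t in 𝓝 x, HasDerivAt g (g' t) t) (h2 : HasDerivAt g' g'' x) :
    g' x = 0 ∧ g'' ≤ 0 := by
  have h0 : g' x = 0 := by
    rw [← h1.self_of_nhds.deriv]
    exact hmax.deriv_eq_zero
  refine ⟨h0, ?_⟩
  by_contra! hpos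
  have hd : deriv g =ᶠ[𝓝 x] g' := h1.mono fun t ht => ht.deriv
  have hdd : deriv (deriv g) x = g'' := by rw [hd.deriv_eq, h2.deriv]
  -- If `g'' > 0`, then `x` is a local minimum as well, so `g` is constant near `x` and its second
  -- derivative vanishes.
  have hmin : IsLocalMin g x :=
    isLocalMin_of_deriv_deriv_pos (by rw [hdd]; exact hpos) (by rw [hd.self_of_nhds, h0])
      h1.self_of_nhds.continuousAt
  have hc : g =ᶠ[𝓝 x] fun _ => g x := by
    filter_upwards [hmax, hmin] with t h3 h4 using le_antisymm h3 h4
  have : deriv g =ᶠ[𝓝 x] fun _ => 0 := by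
    have := hc.deriv
    simpa using this
  have := this.deriv_eq
  rw [hdd] at this
  simp at this
  exact hpos.ne' this

/-! ### Polar coordinates and touching from above. -/

/-- The radial unit vector. -/
noncomputable def radial (θ : ℝ) : Plane := !₂[Real.cos θ, Real.sin θ]

/-- The angular unit vector. -/
noncomputable def angular (θ : ℝ) : Plane := !₂[-Real.sin θ, Real.cos θ]

theorem polar_eq_smul (r θ : ℝ) : polar r θ = r • radial θ := by
  ext i; fin_cases i <;> simp [polar, radial]

theorem hasDerivAt_radial (θ : ℝ) : HasDerivAt radial (angular θ) θ := by
  have h : HasDerivAt (fun t => ![Real.cos t, Real.sin t]) ![-Real.sin θ, Real.cos θ] θ := by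
    rw [hasDerivAt_pi]
    intro i
    fin_cases i
    · exact Real.hasDerivAt_cos θ
    · exact Real.hasDerivAt_sin θ
  exact (PiLp.continuousLinearEquiv 2 ℝ (fun _ : Fin 2 => ℝ)).symm.hasFDerivAt.comp_hasDerivAt θ h

theorem hasDerivAt_angular (θ : ℝ) : HasDerivAt angular (-radial θ) θ := by
  have h : HasDerivAt (fun t => ![-Real.sin t, Real.cos t]) ![-Real.cos θ, -Real.sin θ] θ := by
    rw [hasDerivAt_pi]
    intro i
    fin_cases i
    · exact (Real.hasDerivAt_sin θ).neg
    · exact Real.hasDerivAt_cos θ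
  have he : -radial θ = !₂[-Real.cos θ, -Real.sin θ] := by
    ext i; fin_cases i <;> simp [radial]
  rw [he]
  exact (PiLp.continuousLinearEquiv 2 ℝ (fun _ : Fin 2 => ℝ)).symm.hasFDerivAt.comp_hasDerivAt θ h

/-- The factor `r` makes `(a, b)` the velocity in the `(r, θ)`-plane whose image under polar
coordinates is `ξ`. -/
theorem exists_radial_angular {r : ℝ} (hr : r ≠ 0) (θ : ℝ) (ξ : Plane) :
    ∃ a b : ℝ, ξ = a • radial θ + (r * b) • angular θ := by
  refine ⟨ξ 0 * Real.cos θ + ξ 1 * Real.sin θ, (-ξ 0 * Real.sin θ + ξ 1 * Real.cos θ) / r, ?_⟩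
  rw [mul_div_cancel₀ _ hr]
  ext i
  fin_cases i
  · simp [radial, angular]
    linear_combination (-ξ 0) * Real.sin_sq_add_cos_sq θ
  · simp [radial, angular]
    linear_combination (-ξ 1) * Real.sin_sq_add_cos_sq θ

theorem continuous_polar : Continuous fun q : ℝ × ℝ => polar q.1 q.2 := by
  have h : Continuous radial :=
    continuous_iff_continuousAt.2 fun θ => (hasDerivAt_radial θ).continuousAt
  simp only [polar_eq_smul]
  exact continuous_fst.smul (h.comp continuous_snd)

/-- The derivative is onto for `r ≠ 0`, so polar coordinates are locally open; no injectivity is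
involved. -/
theorem map_nhds_polar {r : ℝ} (hr : r ≠ 0) (θ : ℝ) :
    map (fun q : ℝ × ℝ => polar q.1 q.2) (𝓝 (r, θ)) = 𝓝 (polar r θ) := by
  have hs : HasStrictDerivAt radial (angular θ) θ := by
    refine hasStrictDerivAt_of_hasDerivAt_of_continuousAt
      (Eventually.of_forall fun t => hasDerivAt_radial t) (hasDerivAt_angular θ).continuousAt
  have h2 : HasStrictFDerivAt (fun q : ℝ × ℝ => radial q.2) _ (r, θ) :=
    HasStrictFDerivAt.comp (r, θ) (f := Prod.snd) hs.hasStrictFDerivAt hasStrictFDerivAt_snd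
  have h3 := (hasStrictFDerivAt_fst (𝕜 := ℝ) (p := (r, θ))).smul h2
  simp only [polar_eq_smul]
  refine h3.map_nhds_eq_of_surj ?_
  rw [LinearMap.range_eq_top]
  intro ξ
  obtain ⟨a, b, rfl⟩ := exists_radial_angular hr θ ξ
  refine ⟨(a, b), ?_⟩
  simp [mul_smul]
  abel

theorem isOpen_domain {θ₀ : ℝ} {r₁ r₂ : ℝ → ℝ}
    (h1 : ContinuousOn r₁ (Set.Ici θ₀)) (h2 : ContinuousOn r₂ (Set.Ici θ₀))
    (hpos : ∀ θ, θ₀ ≤ θ → 0 < r₁ θ) : IsOpen (domain θ₀ r₁ r₂) := by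
  rw [isOpen_iff_mem_nhds]
  rintro _ ⟨r, θ, hθ, hr1, hr2, rfl⟩
  rw [← map_nhds_polar ((hpos θ hθ.le).trans hr1).ne' θ, mem_map]
  have c1 : ContinuousAt r₁ θ := h1.continuousAt (Ici_mem_nhds hθ)
  have c2 : ContinuousAt r₂ θ := h2.continuousAt (Ici_mem_nhds hθ)
  have d1 : ContinuousAt (fun q : ℝ × ℝ => r₁ q.2) (r, θ) :=
    ContinuousAt.comp (f := Prod.snd) c1 continuousAt_snd
  have d2 : ContinuousAt (fun q : ℝ × ℝ => r₂ q.2) (r, θ) :=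
    ContinuousAt.comp (f := Prod.snd) c2 continuousAt_snd
  filter_upwards [d1.eventually_lt continuousAt_fst hr1,
    (continuousAt_fst (p := (r, θ))).eventually_lt d2 hr2,
    (continuousAt_const (y := θ₀)).eventually_lt (continuousAt_snd (p := (r, θ))) hθ]
    with q e1 e2 e3
  exact ⟨q.1, q.2, e3, e1, e2, rfl⟩

/-- If `u - G(θ) h(r)` has a local maximum in polar coordinates, the first derivatives agree there
and the second derivatives are ordered. -/
theorem derivs_of_isLocalMax_polar {u : Plane → ℝ} {r θ : ℝ} (hu : ContDiffAt ℝ 2 u (polar r θ))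
    {G G₁ G₂ h h₁ h₂ : ℝ → ℝ} (hG : ∀ t, HasDerivAt G (G₁ t) t) (hG₁ : ∀ t, HasDerivAt G₁ (G₂ t) t)
    (hh : ∀ t, HasDerivAt h (h₁ t) t) (hh₁ : ∀ t, HasDerivAt h₁ (h₂ t) t)
    (hmax : IsLocalMax (fun q : ℝ × ℝ => u (polar q.1 q.2) - G q.2 * h q.1) (r, θ)) (a b : ℝ) :
    fderiv ℝ u (polar r θ) (a • radial θ + (r * b) • angular θ) =
        a * (G θ * h₁ r) + b * (G₁ θ * h r) ∧
    fderiv ℝ (fderiv ℝ u) (polar r θ) (a • radial θ + (r * b) • angular θ)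
        (a • radial θ + (r * b) • angular θ) +
        fderiv ℝ u (polar r θ) ((2 * a * b) • angular θ - (r * b ^ 2) • radial θ) ≤
      a ^ 2 * (G θ * h₂ r) + 2 * a * b * (G₁ θ * h₁ r) + b ^ 2 * (G₂ θ * h r) := by
  -- Test along a straight line of the `(r, θ)`-plane. Its image in the plane is curved, and the
  -- acceleration `c''(0)` accounts for the first-order term in the second conclusion.
  set ρ : ℝ → ℝ := fun t => r + a * t
  set τ : ℝ → ℝ := fun t => θ + b * t
  have hρ : ∀ t, HasDerivAt ρ a t := fun t => by
    have := ((hasDerivAt_id t).const_mul a).const_add r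
    rwa [mul_one] at this
  have hτ : ∀ t, HasDerivAt τ b t := fun t => by
    have := ((hasDerivAt_id t).const_mul b).const_add θ
    rwa [mul_one] at this
  have hρ0 : ρ 0 = r := by simp [ρ]
  have hτ0 : τ 0 = θ := by simp [τ]
  set c : ℝ → Plane := fun t => polar (ρ t) (τ t)
  set c' : ℝ → Plane := fun t => a • radial (τ t) + (ρ t * b) • angular (τ t)
  have hrad : ∀ t, HasDerivAt (fun t => radial (τ t)) (b • angular (τ t)) t := fun t =>
    (hasDerivAt_radial (τ t)).scomp t (hτ t)
  have hang : ∀ t, HasDerivAt (fun t => angular (τ t)) (b • -radial (τ t)) t := fun t =>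
    (hasDerivAt_angular (τ t)).scomp t (hτ t)
  have hc : ∀ t, HasDerivAt c (c' t) t := fun t => by
    have hcr : c = fun t => ρ t • radial (τ t) := funext fun t => polar_eq_smul _ _
    have hct : c' t = ρ t • b • angular (τ t) + a • radial (τ t) := by
      simp only [c', smul_smul]; abel
    rw [hcr, hct]
    exact (hρ t).smul (hrad t)
  have hc' : HasDerivAt c' ((2 * a * b) • angular θ - (r * b ^ 2) • radial θ) 0 := by
    have he : (2 * a * b) • angular θ - (r * b ^ 2) • radial θ =
        a • b • angular (τ 0) + ((ρ 0 * b) • b • -radial (τ 0) + (a * b) • angular (τ 0)) := by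
      rw [hρ0, hτ0]
      module
    rw [he]
    exact ((hrad 0).const_smul a).add (((hρ 0).mul_const b).smul (hang 0))
  have hc0 : c 0 = polar r θ := by simp [c, hρ0, hτ0]
  have hc'0 : c' 0 = a • radial θ + (r * b) • angular θ := by simp [c', hρ0, hτ0]
  have hcc : Tendsto c (𝓝 0) (𝓝 (polar r θ)) := hc0 ▸ (hc 0).continuousAt.tendsto
  have hdiff : ∀ᶠ x in 𝓝 (polar r θ), DifferentiableAt ℝ u x :=
    (hu.eventually (by simp)).mono fun x hx => hx.differentiableAt (by norm_num)
  have hd2 : DifferentiableAt ℝ (fderiv ℝ u) (polar r θ) :=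
    (hu.fderiv_right (m := 1) (by norm_num)).differentiableAt (by norm_num)
  have hGτ : ∀ t, HasDerivAt (fun t => G (τ t)) (G₁ (τ t) * b) t := fun t =>
    (hG (τ t)).comp t (hτ t)
  have hGτ₁ : ∀ t, HasDerivAt (fun t => G₁ (τ t)) (G₂ (τ t) * b) t := fun t =>
    (hG₁ (τ t)).comp t (hτ t)
  have hhρ : ∀ t, HasDerivAt (fun t => h (ρ t)) (h₁ (ρ t) * a) t := fun t =>
    (hh (ρ t)).comp t (hρ t)
  have hhρ₁ : ∀ t, HasDerivAt (fun t => h₁ (ρ t)) (h₂ (ρ t) * a) t := fun t =>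
    (hh₁ (ρ t)).comp t (hρ t)
  have hmax' : IsLocalMax (fun t => u (c t) - G (τ t) * h (ρ t)) 0 := by
    have hT : Tendsto (fun t => (ρ t, τ t)) (𝓝 0) (𝓝 (r, θ)) := by
      have := ((hρ 0).continuousAt.prodMk (hτ 0).continuousAt).tendsto
      simpa only [hρ0, hτ0] using this
    have := hT.eventually hmax
    filter_upwards [this] with t ht
    simpa [c, hρ0, hτ0] using ht
  have hd1 : ∀ᶠ t in 𝓝 (0 : ℝ), HasDerivAt (fun t => u (c t) - G (τ t) * h (ρ t))
      (fderiv ℝ u (c t) (c' t) - (G₁ (τ t) * b * h (ρ t) + G (τ t) * (h₁ (ρ t) * a))) t := by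
    filter_upwards [hcc.eventually hdiff] with t ht
    exact (ht.hasFDerivAt.comp_hasDerivAt t (hc t)).sub ((hGτ t).mul (hhρ t))
  have hfc : HasDerivAt (fun t => fderiv ℝ u (c t))
      (fderiv ℝ (fderiv ℝ u) (polar r θ) (c' 0)) 0 :=
    HasFDerivAt.comp_hasDerivAt (0 : ℝ) (hc0.symm ▸ hd2.hasFDerivAt) (hc 0)
  have hdd := (hfc.clm_apply hc').sub
    ((((hGτ₁ 0).mul_const b).mul (hhρ 0)).add ((hGτ 0).mul ((hhρ₁ 0).mul_const a)))
  obtain ⟨e1, e2⟩ := second_order_of_isLocalMax hmax' hd1 hdd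
  rw [hc0, hc'0, hρ0, hτ0] at e1
  simp only [hc0, hc'0, hρ0, hτ0] at e2
  constructor
  · linarith
  · linarith

/-! ### The operator at a touching point of a barrier. -/

/-- Cholesky factorization. It turns `∑ aᵢⱼ ∂ᵢⱼu` into two pure second derivatives, which can be
bounded along curves. -/
theorem exists_sum_sq_of_elliptic {M : Matrix (Fin 2) (Fin 2) ℝ} (hM : M.IsSymm) {c₀ : ℝ}
    (hc₀ : 0 < c₀) (h : ∀ ξ : Plane, c₀ * ‖ξ‖ ^ 2 ≤ ∑ i, ∑ j, ξ i * M i j * ξ j) :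
    ∃ ξ η : Plane, ∀ i j, M i j = ξ i * ξ j + η i * η j := by
  have h01 : M 1 0 = M 0 1 := hM.apply 0 1
  have ha : 0 < M 0 0 := by
    have := h !₂[1, 0]
    simp [EuclideanSpace.norm_sq_eq, Fin.sum_univ_two] at this
    linarith
  have hd : 0 ≤ M 1 1 - M 0 1 ^ 2 / M 0 0 := by
    -- This vector minimizes the form among those with second entry 1; the value there is the Schur
    -- complement.
    have := h !₂[-M 0 1 / M 0 0, 1]
    simp [EuclideanSpace.norm_sq_eq, Fin.sum_univ_two, h01] at this
    have he : -M 0 1 / M 0 0 * M 0 0 * (-M 0 1 / M 0 0) + -M 0 1 / M 0 0 * M 0 1 +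
        (M 0 1 * (-M 0 1 / M 0 0) + M 1 1) = M 1 1 - M 0 1 ^ 2 / M 0 0 := by
      field_simp; ring
    rw [← he]
    refine le_trans ?_ this
    positivity
  have hs := Real.mul_self_sqrt ha.le
  have hs0 : Real.sqrt (M 0 0) ≠ 0 := (Real.sqrt_pos.2 ha).ne'
  have ht := Real.mul_self_sqrt hd
  refine ⟨!₂[Real.sqrt (M 0 0), M 0 1 / Real.sqrt (M 0 0)],
    !₂[0, Real.sqrt (M 1 1 - M 0 1 ^ 2 / M 0 0)], ?_⟩
  intro i j
  fin_cases i <;> fin_cases j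
  · simp [hs]
  · simp; field_simp
  · simp [h01]; field_simp
  · simp [ht]
    rw [div_mul_div_comm, hs]
    ring

theorem eq_sum_single (ξ : Plane) :
    ξ = ξ 0 • EuclideanSpace.single 0 1 + ξ 1 • EuclideanSpace.single 1 1 := by
  ext i; fin_cases i <;> simp

theorem ellipticOp_eq {A : Plane → Matrix (Fin 2) (Fin 2) ℝ} {b : Plane → Plane} {u : Plane → ℝ}
    {p : Plane} (hu : ContDiffAt ℝ 2 u p) {ξ η : Plane}
    (hA : ∀ i j, A p i j = ξ i * ξ j + η i * η j) :
    ellipticOp A b u p = -(fderiv ℝ (fderiv ℝ u) p ξ ξ + fderiv ℝ (fderiv ℝ u) p η η) +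
      fderiv ℝ u p (b p) := by
  have hd2 : DifferentiableAt ℝ (fderiv ℝ u) p :=
    (hu.fderiv_right (m := 1) (by norm_num)).differentiableAt (by norm_num)
  have hpd : ∀ i j, partialDeriv i (partialDeriv j u) p =
      fderiv ℝ (fderiv ℝ u) p (EuclideanSpace.single i 1) (EuclideanSpace.single j 1) := by
    intro i j
    have := (hd2.hasFDerivAt.clm_apply
      (hasFDerivAt_const (EuclideanSpace.single j (1 : ℝ) : Plane) p)).fderiv
    change fderiv ℝ (fun x => fderiv ℝ u x (EuclideanSpace.single j 1)) p _ = _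
    rw [this]
    simp
  have hq : ∀ ζ : Plane, fderiv ℝ (fderiv ℝ u) p ζ ζ =
      ∑ i, ∑ j, ζ i * ζ j * partialDeriv i (partialDeriv j u) p := by
    intro ζ
    conv_lhs => rw [eq_sum_single ζ]
    simp only [hpd, map_add, map_smul, add_apply,
      smul_apply, smul_eq_mul, Fin.sum_univ_two]
    ring
  have hb : fderiv ℝ u p (b p) = ∑ i, b p i * partialDeriv i u p := by
    conv_lhs => rw [eq_sum_single (b p)]
    simp only [map_add, map_smul, smul_eq_mul, Fin.sum_univ_two, partialDeriv]
  rw [hq, hq, hb, ellipticOp]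
  simp only [hA, Fin.sum_univ_two]
  ring

theorem norm_sq_polar_frame (θ a b : ℝ) :
    ‖a • radial θ + b • angular θ‖ ^ 2 = a ^ 2 + b ^ 2 := by
  simp [EuclideanSpace.norm_sq_eq, Fin.sum_univ_two, radial, angular]
  linear_combination (a ^ 2 + b ^ 2) * Real.sin_sq_add_cos_sq θ

theorem inner_radial_frame (θ a b : ℝ) :
    (a • radial θ + b • angular θ) 0 * radial θ 0 +
      (a • radial θ + b • angular θ) 1 * radial θ 1 = a := by
  simp [radial, angular]
  linear_combination a * Real.sin_sq_add_cos_sq θ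

theorem norm_sq_radial (θ : ℝ) : ‖radial θ‖ ^ 2 = 1 := by
  simpa using norm_sq_polar_frame θ 1 0

theorem div_le_div_barrier {r ρ e B : ℝ} (hρ : 0 < ρ) (hρr : ρ ≤ r) (he : 1 ≤ e) (heB : e ≤ B) :
    0 ≤ (B - e) / r ∧ (B - e) / r ≤ B / ρ := by
  refine ⟨div_nonneg (by linarith) (by linarith), ?_⟩
  exact div_le_div₀ (by linarith) (by linarith) hρ hρr

/-- Here `g, g₁, g₂` stand for `G, G', G''` at the point and `e` for `e^{kr}`. The radial term is
kept in full, the curvature term `-r t² g k e` has the good sign and is dropped, and all the rest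
carries a factor `ν`. -/
theorem polar_hessian_barrier_le {g g₁ g₂ r ρ e B k ν : ℝ} (hρ : 0 < ρ) (hρr : ρ ≤ r) (hk : 0 ≤ k)
    (he : 1 ≤ e) (heB : e ≤ B) (hν : 0 ≤ ν) (hν1 : ν ≤ 1) (hg : 0 ≤ g) (hg₁ : |g₁| ≤ ν * g)
    (hg₂ : g₂ ≤ ν ^ 2 * g) (s t : ℝ) :
    s ^ 2 * (g * -(k * (k * e))) + 2 * s * t * (g₁ * -(k * e)) + t ^ 2 * (g₂ * (B - e)) -
        (2 * s * t * (g₁ * (B - e) / r) - r * t ^ 2 * -(g * (k * e))) ≤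
      -(s ^ 2 * (g * (k * (k * e)))) +
        (s ^ 2 + t ^ 2) * (ν * g * (k * B + B / ρ)) + t ^ 2 * (ν * g * B) := by
  have hr : 0 < r := by linarith
  have he0 : 0 ≤ e := by linarith
  have hcross : -(2 * s * t * (g₁ * (k * e + (B - e) / r))) ≤
      (s ^ 2 + t ^ 2) * (ν * g * (k * B + B / ρ)) := by
    obtain ⟨hn, hle⟩ := div_le_div_barrier hρ hρr he heB
    have hke : k * e ≤ k * B := by gcongr
    have hke0 : 0 ≤ k * e := by positivity
    have hst : |2 * s * t| ≤ s ^ 2 + t ^ 2 := by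
      rw [abs_le]; constructor <;> linarith [sq_nonneg (s + t), sq_nonneg (s - t), add_sq s t, sub_sq s t]
    calc -(2 * s * t * (g₁ * (k * e + (B - e) / r)))
        ≤ |2 * s * t * (g₁ * (k * e + (B - e) / r))| := neg_le_abs _
      _ = |2 * s * t| * (|g₁| * (k * e + (B - e) / r)) := by
          rw [abs_mul, abs_mul (g₁), abs_of_nonneg (add_nonneg hke0 hn)]
      _ ≤ (s ^ 2 + t ^ 2) * (ν * g * (k * B + B / ρ)) := by
          gcongr
  have hG2 : t ^ 2 * (g₂ * (B - e)) ≤ t ^ 2 * (ν * g * B) := by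
    have h0 : g₂ ≤ ν * g := by
      refine hg₂.trans ?_
      have : ν ^ 2 ≤ ν := by nlinarith
      gcongr
    have : 0 ≤ B - e := by linarith
    calc t ^ 2 * (g₂ * (B - e)) ≤ t ^ 2 * (ν * g * (B - e)) := by gcongr
      _ ≤ t ^ 2 * (ν * g * B) := by gcongr; linarith
  have hneg : 0 ≤ r * t ^ 2 * (g * (k * e)) := by positivity
  have hdiv : 2 * s * t * (g₁ * (B - e) / r) = 2 * s * t * (g₁ * ((B - e) / r)) := by ring
  rw [hdiv]
  linarith

/-- The functions `G(θ) (B - e^{kr})` are strict supersolutions when `G` varies slowly: a function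
touched from above by such a function cannot be a subsolution. -/
theorem ellipticOp_pos_of_isLocalMax {A : Plane → Matrix (Fin 2) (Fin 2) ℝ} {b : Plane → Plane}
    {u : Plane → ℝ} {r θ : ℝ} (hu : ContDiffAt ℝ 2 u (polar r θ))
    {c₀ M₁ M₂ ρ R k B ν : ℝ} (hsymm : (A (polar r θ)).IsSymm) (hc₀ : 0 < c₀)
    (hM₂ : 0 ≤ M₂)
    (hA : ∀ ξ : Plane, c₀ * ‖ξ‖ ^ 2 ≤ ∑ i, ∑ j, ξ i * A (polar r θ) i j * ξ j)
    (htr : (A (polar r θ)).trace ≤ M₁) (hb : ‖b (polar r θ)‖ ≤ M₂)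
    (hρ : 0 < ρ) (hρr : ρ ≤ r) (hrR : r ≤ R) (hk : 0 < k) (hkc : k * c₀ = M₂ + 1)
    (hB : Real.exp (k * R) ≤ B) (hν : 0 ≤ ν) (hν1 : ν ≤ 1)
    (hνk : ν * ((M₁ + M₁ / ρ ^ 2) * (k * B + B / ρ) + M₁ / ρ ^ 2 * B + M₂ * (B / ρ)) < k)
    {G G₁ G₂ : ℝ → ℝ} (hG : ∀ t, HasDerivAt G (G₁ t) t) (hG₁ : ∀ t, HasDerivAt G₁ (G₂ t) t)
    (hGpos : 0 < G θ) (hG₁le : |G₁ θ| ≤ ν * G θ) (hG₂le : G₂ θ ≤ ν ^ 2 * G θ)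
    (hmax : IsLocalMax
      (fun q : ℝ × ℝ => u (polar q.1 q.2) - G q.2 * (B - Real.exp (k * q.1))) (r, θ)) :
    0 < ellipticOp A b u (polar r θ) := by
  have hr : 0 < r := hρ.trans_le hρr
  have hexp : ∀ t : ℝ, HasDerivAt (fun s => Real.exp (k * s)) (k * Real.exp (k * t)) t := by
    intro t
    have := ((hasDerivAt_id t).const_mul k).exp
    simpa [mul_comm] using this
  have hh : ∀ t : ℝ, HasDerivAt (fun s => B - Real.exp (k * s)) (-(k * Real.exp (k * t))) t :=
    fun t => (hexp t).const_sub B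
  have hh₁ : ∀ t : ℝ, HasDerivAt (fun s => -(k * Real.exp (k * s)))
      (-(k * (k * Real.exp (k * t)))) t := fun t => ((hexp t).const_mul k).neg
  have key := derivs_of_isLocalMax_polar hu hG hG₁ hh hh₁ hmax
  obtain ⟨ξ, η, hξη⟩ := exists_sum_sq_of_elliptic hsymm hc₀ hA
  rw [ellipticOp_eq hu hξη]
  set e := Real.exp (k * r) with he
  have he1 : 1 ≤ e := Real.one_le_exp (by positivity)
  have heB : e ≤ B := (Real.exp_le_exp.2 (by gcongr)).trans hB
  have hrad := hA (radial θ)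
  rw [norm_sq_radial] at hrad
  have htr' : ‖ξ‖ ^ 2 + ‖η‖ ^ 2 ≤ M₁ := by
    rw [Matrix.trace_fin_two, hξη, hξη] at htr
    simp only [EuclideanSpace.norm_sq_eq, Fin.sum_univ_two, Real.norm_eq_abs, sq_abs]
    linarith
  obtain ⟨s₁, t₁, e₁⟩ := exists_radial_angular hr.ne' θ ξ
  obtain ⟨s₂, t₂, e₂⟩ := exists_radial_angular hr.ne' θ η
  obtain ⟨β, δ, e₃⟩ := exists_radial_angular hr.ne' θ (b (polar r θ))
  -- The sum on the right is the quadratic form of `A` on the radial unit vector.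
  have hc : c₀ ≤ s₁ ^ 2 + s₂ ^ 2 := by
    have h1 := inner_radial_frame θ s₁ (r * t₁)
    have h2 := inner_radial_frame θ s₂ (r * t₂)
    rw [← e₁] at h1
    rw [← e₂] at h2
    simp only [hξη, Fin.sum_univ_two] at hrad
    rw [← h1, ← h2]
    linarith
  have hM : s₁ ^ 2 + s₂ ^ 2 + r ^ 2 * (t₁ ^ 2 + t₂ ^ 2) ≤ M₁ := by
    rw [e₁, e₂, norm_sq_polar_frame, norm_sq_polar_frame] at htr'
    linarith
  have hbd : β ^ 2 + (r * δ) ^ 2 ≤ M₂ ^ 2 := by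
    rw [← norm_sq_polar_frame θ, ← e₃]
    gcongr
  have hDrad : fderiv ℝ u (polar r θ) (radial θ) = -(G θ * (k * e)) := by
    simpa using (key 1 0).1
  have hDang : fderiv ℝ u (polar r θ) (angular θ) = G₁ θ * (B - e) / r := by
    have := (key 0 1).1
    simp at this
    field_simp
    linarith
  have hquad : ∀ s t : ℝ, fderiv ℝ (fderiv ℝ u) (polar r θ)
      (s • radial θ + (r * t) • angular θ) (s • radial θ + (r * t) • angular θ) ≤
      -(s ^ 2 * (G θ * (k * (k * e)))) +
        (s ^ 2 + t ^ 2) * (ν * G θ * (k * B + B / ρ)) + t ^ 2 * (ν * G θ * B) := by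
    intro s t
    have h2 := (key s t).2
    simp only [map_sub, map_smul, hDrad, hDang, smul_eq_mul] at h2
    have h3 := polar_hessian_barrier_le hρ hρr hk.le he1 heB hν hν1 hGpos.le hG₁le hG₂le s t
    linarith
  have hDb : -(M₂ * (G θ * (k * e))) - M₂ * (ν * G θ * (B / ρ)) ≤
      fderiv ℝ u (polar r θ) (b (polar r θ)) := by
    rw [e₃, map_add, map_smul, map_smul, hDrad, hDang, smul_eq_mul, smul_eq_mul]
    have hβ : β ≤ M₂ := (abs_le_of_sq_le_sq' (by linarith [sq_nonneg (r * δ)]) hM₂).2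
    have hδ : |r * δ| ≤ M₂ := abs_le_of_sq_le_sq (by linarith [sq_nonneg β]) hM₂
    have h1 : β * (G θ * (k * e)) ≤ M₂ * (G θ * (k * e)) := by gcongr
    have h2 : |r * δ * (G₁ θ * (B - e) / r)| ≤ M₂ * (ν * G θ * (B / ρ)) := by
      obtain ⟨hn, hle⟩ := div_le_div_barrier hρ hρr he1 heB
      rw [mul_div_assoc, abs_mul, abs_mul (G₁ θ), abs_of_nonneg hn]
      gcongr
    have := (abs_le.1 h2).1
    linarith
  have hq1 := hquad s₁ t₁
  have hq2 := hquad s₂ t₂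
  rw [← e₁] at hq1
  rw [← e₂] at hq2
  have hρ2 : t₁ ^ 2 + t₂ ^ 2 ≤ M₁ / ρ ^ 2 := by
    rw [le_div_iff₀ (by positivity)]
    have : ρ ^ 2 ≤ r ^ 2 := by gcongr
    have : (t₁ ^ 2 + t₂ ^ 2) * ρ ^ 2 ≤ (t₁ ^ 2 + t₂ ^ 2) * r ^ 2 := by gcongr
    linarith [sq_nonneg s₁, sq_nonneg s₂]
  have hs : s₁ ^ 2 + s₂ ^ 2 ≤ M₁ := by
    have : 0 ≤ r ^ 2 * (t₁ ^ 2 + t₂ ^ 2) := by positivity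
    linarith
  have hB0 : 0 < B := by linarith
  have b1 : c₀ * (G θ * (k * (k * e))) ≤ (s₁ ^ 2 + s₂ ^ 2) * (G θ * (k * (k * e))) := by gcongr
  have b2 : (s₁ ^ 2 + s₂ ^ 2 + (t₁ ^ 2 + t₂ ^ 2)) * (ν * G θ * (k * B + B / ρ)) ≤
      (M₁ + M₁ / ρ ^ 2) * (ν * G θ * (k * B + B / ρ)) := by gcongr
  have b3 : (t₁ ^ 2 + t₂ ^ 2) * (ν * G θ * B) ≤ M₁ / ρ ^ 2 * (ν * G θ * B) := by gcongr
  have b4 : 0 < G θ * (k - ν * ((M₁ + M₁ / ρ ^ 2) * (k * B + B / ρ) + M₁ / ρ ^ 2 * B +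
      M₂ * (B / ρ))) := mul_pos hGpos (by linarith)
  -- The choice `k c₀ = M₂ + 1`: radial diffusion absorbs the radial drift and leaves `G k e ≥ G k`,
  -- which by `hνk` exceeds all terms with a factor `ν`.
  have b5 : c₀ * (G θ * (k * (k * e))) = M₂ * (G θ * (k * e)) + G θ * (k * e) := by
    linear_combination (G θ * k * e) * hkc
  have b6 : G θ * k ≤ G θ * (k * e) := by
    have : k ≤ k * e := le_mul_of_one_le_right hk.le he1
    gcongr
  linarith

/-! ### Comparison between two cross-sections. -/

theorem polar_mem_extDomain {θ₀ : ℝ} {r₁ r₂ : ℝ → ℝ} {r θ : ℝ} (hθ : θ₀ ≤ θ) (h1 : r₁ θ ≤ r)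
    (h2 : r ≤ r₂ θ) : polar r θ ∈ extDomain θ₀ r₁ r₂ := ⟨r, θ, hθ, h1, h2, rfl⟩

/-- Comparison on the part of the domain between two cross-sections: if the boundary inequality
`u ≤ Φ` failed inside, `u - Φ` would have an interior maximum. -/
theorem le_of_not_isLocalMax {θ₀ α β : ℝ} {r₁ r₂ : ℝ → ℝ}
    (hc1 : ContinuousOn r₁ (Set.Ici θ₀)) (hc2 : ContinuousOn r₂ (Set.Ici θ₀))
    (hr : ∀ θ, θ₀ ≤ θ → r₁ θ < r₂ θ) {u : Plane → ℝ}
    (hu : ContinuousOn u (extDomain θ₀ r₁ r₂)) {Φ : ℝ × ℝ → ℝ} (hΦ : Continuous Φ) (hα : θ₀ ≤ α)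
    (h1 : ∀ θ ∈ Set.Icc α β, u (polar (r₁ θ) θ) ≤ Φ (r₁ θ, θ))
    (h2 : ∀ θ ∈ Set.Icc α β, u (polar (r₂ θ) θ) ≤ Φ (r₂ θ, θ))
    (h3 : ∀ r, r₁ α ≤ r → r ≤ r₂ α → u (polar r α) ≤ Φ (r, α))
    (h4 : ∀ r, r₁ β ≤ r → r ≤ r₂ β → u (polar r β) ≤ Φ (r, β))
    (h5 : ∀ r θ, α < θ → θ < β → r₁ θ < r → r < r₂ θ →
      ¬ IsLocalMax (fun q : ℝ × ℝ => u (polar q.1 q.2) - Φ q) (r, θ))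
    {r θ : ℝ} (hθ : θ ∈ Set.Icc α β) (hr1 : r₁ θ ≤ r) (hr2 : r ≤ r₂ θ) :
    u (polar r θ) ≤ Φ (r, θ) := by
  set F : ℝ × ℝ → ℝ := fun q => u (polar q.1 q.2) - Φ q with hF
  set K : Set (ℝ × ℝ) := {q | q.2 ∈ Set.Icc α β ∧ r₁ q.2 ≤ q.1 ∧ q.1 ≤ r₂ q.2} with hK
  have hsub : ∀ t ∈ Set.Icc α β, t ∈ Set.Ici θ₀ := fun t ht => hα.trans ht.1
  -- Straightening the strip exhibits `K` as a continuous image of a rectangle.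
  have hKc : IsCompact K := by
    have him : K = (fun q : ℝ × ℝ => (r₁ q.2 + q.1 * (r₂ q.2 - r₁ q.2), q.2)) ''
        (Set.Icc 0 1 ×ˢ Set.Icc α β) := by
      ext ⟨s, t⟩
      constructor
      · rintro ⟨ht, hs1, hs2⟩
        have hd : 0 < r₂ t - r₁ t := sub_pos.2 (hr t (hsub t ht))
        refine ⟨((s - r₁ t) / (r₂ t - r₁ t), t), ⟨⟨?_, ?_⟩, ht⟩, ?_⟩
        · exact div_nonneg (sub_nonneg.2 hs1) hd.le
        · exact (div_le_one hd).2 (sub_le_sub_right hs2 _)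
        · simp [div_mul_cancel₀ _ hd.ne']
      · rintro ⟨⟨c, t'⟩, ⟨⟨hc0, hc1⟩, ht⟩, h⟩
        simp only [Prod.mk.injEq] at h
        obtain ⟨rfl, rfl⟩ := h
        have hd : 0 < r₂ t' - r₁ t' := sub_pos.2 (hr t' (hsub t' ht))
        simp only at hc0 hc1
        refine ⟨ht, ?_, ?_⟩
        · simp only; nlinarith
        · simp only; nlinarith
    rw [him]
    refine (isCompact_Icc.prod isCompact_Icc).image_of_continuousOn ?_
    have e1 : ContinuousOn (fun q : ℝ × ℝ => r₁ q.2) (Set.Icc 0 1 ×ˢ Set.Icc α β) :=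
      hc1.comp continuousOn_snd fun q hq => hsub _ hq.2
    have e2 : ContinuousOn (fun q : ℝ × ℝ => r₂ q.2) (Set.Icc 0 1 ×ˢ Set.Icc α β) :=
      hc2.comp continuousOn_snd fun q hq => hsub _ hq.2
    exact (e1.add (continuousOn_fst.mul (e2.sub e1))).prodMk continuousOn_snd
  have hFc : ContinuousOn F K :=
    (hu.comp continuous_polar.continuousOn fun q hq =>
      polar_mem_extDomain (hsub _ hq.1) hq.2.1 hq.2.2).sub hΦ.continuousOn
  obtain ⟨⟨s, t⟩, ⟨ht, hs1, hs2⟩, hmax⟩ := hKc.exists_isMaxOn ⟨(r, θ), hθ, hr1, hr2⟩ hFc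
  have hle : F (r, θ) ≤ F (s, t) := hmax ⟨hθ, hr1, hr2⟩
  simp only at ht hs1 hs2
  suffices F (s, t) ≤ 0 by
    have := hle.trans this
    simp only [hF] at this
    linarith
  by_contra! hpos
  simp only [hF] at hpos
  have hs1' : r₁ t < s := hs1.lt_of_ne (by rintro rfl; linarith [h1 t ht])
  have hs2' : s < r₂ t := hs2.lt_of_ne (by rintro rfl; linarith [h2 t ht])
  have htα : α < t := ht.1.lt_of_ne (by rintro rfl; linarith [h3 s hs1 hs2])
  have htβ : t < β := ht.2.lt_of_ne (by rintro rfl; linarith [h4 s hs1 hs2])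
  refine h5 s t htα htβ hs1' hs2' ?_
  refine hmax.isLocalMax ?_
  have c1 : ContinuousAt r₁ t := hc1.continuousAt (Ici_mem_nhds (hα.trans_lt htα))
  have c2 : ContinuousAt r₂ t := hc2.continuousAt (Ici_mem_nhds (hα.trans_lt htα))
  have d1 : ContinuousAt (fun q : ℝ × ℝ => r₁ q.2) (s, t) :=
    ContinuousAt.comp (f := Prod.snd) c1 continuousAt_snd
  have d2 : ContinuousAt (fun q : ℝ × ℝ => r₂ q.2) (s, t) :=
    ContinuousAt.comp (f := Prod.snd) c2 continuousAt_snd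
  filter_upwards [d1.eventually_lt continuousAt_fst hs1',
    (continuousAt_fst (p := (s, t))).eventually_lt d2 hs2',
    (continuousAt_const (y := α)).eventually_lt (continuousAt_snd (p := (s, t))) htα,
    (continuousAt_snd (p := (s, t))).eventually_lt (continuousAt_const (y := β)) htβ]
    with q e1 e2 e3 e4
  exact ⟨⟨e3.le, e4.le⟩, e1.le, e2.le⟩

theorem exists_pos_lower_bound {f : ℝ → ℝ} {θ₀ l : ℝ} (hf : ContinuousOn f (Set.Ici θ₀))
    (hpos : ∀ θ, θ₀ ≤ θ → 0 < f θ) (hl : 0 < l) (hlim : Tendsto f atTop (𝓝 l)) :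
    ∃ ρ, 0 < ρ ∧ ∀ θ, θ₀ ≤ θ → ρ ≤ f θ := by
  obtain ⟨T, hT⟩ := eventually_atTop.1 (hlim.eventually (lt_mem_nhds (half_lt_self hl)))
  obtain ⟨x, hx, hmin⟩ := isCompact_Icc.exists_isMinOn
    (Set.nonempty_Icc.2 (le_max_left θ₀ T)) (hf.mono fun t ht => ht.1)
  refine ⟨min (l / 2) (f x), lt_min (half_pos hl) (hpos x hx.1), fun θ hθ => ?_⟩
  rcases le_total θ (max θ₀ T) with h | h
  · exact (min_le_right _ _).trans (hmin ⟨hθ, h⟩)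
  · exact (min_le_left _ _).trans (hT θ ((le_max_right _ _).trans h)).le

theorem exists_upper_bound {f : ℝ → ℝ} {θ₀ l : ℝ} (hf : ContinuousOn f (Set.Ici θ₀))
    (hlim : Tendsto f atTop (𝓝 l)) : ∃ R, ∀ θ, θ₀ ≤ θ → f θ ≤ R := by
  obtain ⟨T, hT⟩ := eventually_atTop.1 (hlim.eventually (gt_mem_nhds (lt_add_one l)))
  obtain ⟨x, hx, hmax⟩ := isCompact_Icc.exists_isMaxOn
    (Set.nonempty_Icc.2 (le_max_left θ₀ T)) (hf.mono fun t ht => ht.1)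
  refine ⟨max (l + 1) (f x), fun θ hθ => ?_⟩
  rcases le_total θ (max θ₀ T) with h | h
  · exact (hmax ⟨hθ, h⟩).trans (le_max_right _ _)
  · exact (hT θ ((le_max_right _ _).trans h)).le.trans (le_max_left _ _)

/-- Bounds on two cross-sections propagate to the part of the domain between them, with
exponential decay away from both. -/
def TwoSidedBound (θ₀ : ℝ) (r₁ r₂ : ℝ → ℝ) (ν : ℝ) (f : Plane → ℝ) : Prop :=
  ∀ α β P Q : ℝ, θ₀ ≤ α → 0 ≤ P → 0 ≤ Q →
    (∀ x ∈ crossSection r₁ r₂ α, f x ≤ P) → (∀ x ∈ crossSection r₁ r₂ β, f x ≤ Q) →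
    ∀ θ ∈ Set.Icc α β, ∀ x ∈ crossSection r₁ r₂ θ,
      f x ≤ max P Q ∧ f x ≤ 2 * (P * Real.exp (-ν * (θ - α)) + Q * Real.exp (-ν * (β - θ)))

-- Two barriers are used: a nearly constant one for the bound by `max P Q`, and one with
-- exponentials from both ends for the decay. The rate depends only on the coefficient bounds and on
-- `ρ ≤ r₁`, `r₂ ≤ R`.
set_option maxHeartbeats 1000000 in
theorem exists_twoSidedBound {θ₀ rstar : ℝ} {r₁ r₂ : ℝ → ℝ}
    (hc1 : ContinuousOn r₁ (Set.Ici θ₀)) (hc2 : ContinuousOn r₂ (Set.Ici θ₀))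
    (hpos : ∀ θ, θ₀ ≤ θ → 0 < r₁ θ) (hr : ∀ θ, θ₀ ≤ θ → r₁ θ < r₂ θ) (hrstar : 0 < rstar)
    (hl1 : Tendsto r₁ atTop (𝓝 rstar)) (hl2 : Tendsto r₂ atTop (𝓝 rstar))
    {A : Plane → Matrix (Fin 2) (Fin 2) ℝ} {b : Plane → Plane}
    (hA : IsElliptic (domain θ₀ r₁ r₂) A) (hb : IsBoundedDrift (domain θ₀ r₁ r₂) b) :
    ∃ ν : ℝ, 0 < ν ∧ ∀ u : Plane → ℝ, ContDiffOn ℝ 2 u (domain θ₀ r₁ r₂) →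
      ContinuousOn u (extDomain θ₀ r₁ r₂) → (∀ x ∈ domain θ₀ r₁ r₂, ellipticOp A b u x ≤ 0) →
      (∀ x ∈ lateral θ₀ r₁ r₂, u x ≤ 0) → TwoSidedBound θ₀ r₁ r₂ ν u := by
  obtain ⟨hsymm, c₀, M₁, hc₀, hM₁, hell, htr⟩ := hA
  obtain ⟨M₂, hM₂, hdrift⟩ := hb
  obtain ⟨ρ, hρ, hρr⟩ := exists_pos_lower_bound hc1 hpos hrstar hl1
  obtain ⟨R, hR⟩ := exists_upper_bound hc2 hl2
  have hR0 : 0 ≤ R := ((hpos _ le_rfl).trans (hr _ le_rfl)).le.trans (hR θ₀ le_rfl)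
  set k := (M₂ + 1) / c₀
  have hk : 0 < k := by positivity
  have hkc : k * c₀ = M₂ + 1 := div_mul_cancel₀ _ hc₀.ne'
  set E := Real.exp (k * R)
  have hE : 0 < E := Real.exp_pos _
  -- The error factor of `ellipticOp_pos_of_isLocalMax` for `B = 2E`; the rate `min 1 (k / (D + 1))`
  -- keeps its product with `D` below `k`.
  set D := (M₁ + M₁ / ρ ^ 2) * (k * (2 * E) + 2 * E / ρ) + M₁ / ρ ^ 2 * (2 * E) +
    M₂ * (2 * E / ρ) with hD
  have hD0 : 0 ≤ D := by positivity
  have hνD : min 1 (k / (D + 1)) * D < k := by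
    calc min 1 (k / (D + 1)) * D ≤ k / (D + 1) * D := by gcongr; exact min_le_right _ _
      _ < k / (D + 1) * (D + 1) := by gcongr; linarith
      _ = k := div_mul_cancel₀ _ (by positivity)
  have hν : 0 < min 1 (k / (D + 1)) := lt_min one_pos (by positivity)
  have hν1 : min 1 (k / (D + 1)) ≤ 1 := min_le_left _ _
  set ν := min 1 (k / (D + 1))
  refine ⟨ν, hν, fun u hu2 huc hLu hlat α β P Q hα hP hQ hPα hQβ => ?_⟩
  have hexpE : ∀ θ, θ₀ ≤ θ → ∀ r, r ≤ r₂ θ → Real.exp (k * r) ≤ E := fun θ hθ r hr2 =>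
    Real.exp_le_exp.2 (mul_le_mul_of_nonneg_left (hr2.trans (hR θ hθ)) hk.le)
  have hcomp : ∀ (B μ : ℝ) (G G₁ G₂ : ℝ → ℝ), E ≤ B → 0 ≤ μ → μ ≤ 1 →
      μ * ((M₁ + M₁ / ρ ^ 2) * (k * B + B / ρ) + M₁ / ρ ^ 2 * B + M₂ * (B / ρ)) < k →
      (∀ t, HasDerivAt G (G₁ t) t) → (∀ t, HasDerivAt G₁ (G₂ t) t) → (∀ t, 0 < G t) →
      (∀ t, |G₁ t| ≤ μ * G t) → (∀ t, G₂ t ≤ μ ^ 2 * G t) →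
      P ≤ G α * (B - E) → Q ≤ G β * (B - E) →
      ∀ θ ∈ Set.Icc α β, ∀ r, r₁ θ ≤ r → r ≤ r₂ θ →
        u (polar r θ) ≤ G θ * (B - Real.exp (k * r)) := by
    intro B μ G G₁ G₂ hB hμ hμ1 hμk hG hG₁ hGpos hG₁le hG₂le hGα hGβ θ hθ r hr1 hr2
    have hGc : Continuous G := continuous_iff_continuousAt.2 fun t => (hG t).continuousAt
    have hnn : ∀ t, θ₀ ≤ t → ∀ s, s ≤ r₂ t → 0 ≤ G t * (B - Real.exp (k * s)) :=
      fun t ht s hs => mul_nonneg (hGpos t).le (by linarith [hexpE t ht s hs])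
    have hmono : ∀ t, θ₀ ≤ t → ∀ s, s ≤ r₂ t →
        G t * (B - E) ≤ G t * (B - Real.exp (k * s)) :=
      fun t ht s hs => mul_le_mul_of_nonneg_left (by linarith [hexpE t ht s hs]) (hGpos t).le
    refine le_of_not_isLocalMax (Φ := fun q => G q.2 * (B - Real.exp (k * q.1))) hc1 hc2 hr huc
      (by fun_prop) hα ?_ ?_ ?_ ?_ ?_ hθ hr1 hr2
    · intro t ht
      have ht0 := hα.trans ht.1
      exact (hlat _ (Or.inl ⟨t, ht0, rfl⟩)).trans (hnn t ht0 _ (hr t ht0).le)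
    · intro t ht
      have ht0 := hα.trans ht.1
      exact (hlat _ (Or.inr ⟨t, ht0, rfl⟩)).trans (hnn t ht0 _ le_rfl)
    · exact fun s hs1 hs2 => ((hPα _ ⟨s, hs1, hs2, rfl⟩).trans hGα).trans (hmono α hα s hs2)
    · exact fun s hs1 hs2 => ((hQβ _ ⟨s, hs1, hs2, rfl⟩).trans hGβ).trans
        (hmono β (hα.trans (hθ.1.trans hθ.2)) s hs2)
    · intro s t hαt htβ hs1 hs2 hmax
      have ht0 : θ₀ < t := hα.trans_lt hαt
      have hmem : polar s t ∈ domain θ₀ r₁ r₂ := ⟨s, t, ht0, hs1, hs2, rfl⟩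
      have hopen := isOpen_domain hc1 hc2 hpos
      refine absurd (hLu _ hmem) (not_le.2 ?_)
      exact ellipticOp_pos_of_isLocalMax (hu2.contDiffAt (hopen.mem_nhds hmem)) (hsymm _ hmem) hc₀
        hM₂ (hell _ hmem) (htr _ hmem) (hdrift _ hmem) hρ ((hρr t ht0.le).trans hs1.le)
        (hs2.le.trans (hR t ht0.le)) hk hkc hB hμ hμ1 hμk hG hG₁ (hGpos t) (hG₁le t) (hG₂le t) hmax
  rintro θ hθ _ ⟨r, hr1, hr2, rfl⟩
  constructor
  -- For constant `G` the rate is 0 and `B` is free. With `G = ε / E` and this `B`, the barrier is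
  -- at least `G (B - E) = max P Q` and at most `G B = max P Q + ε`.
  · refine le_of_forall_pos_le_add fun ε hε => ?_
    have hm : 0 ≤ max P Q := hP.trans (le_max_left _ _)
    have he : ε / E * (max P Q / (ε / E) + E - E) = max P Q := by field_simp; ring
    have := hcomp (max P Q / (ε / E) + E) 0 (fun _ => ε / E) (fun _ => 0) (fun _ => 0)
      (by linarith [div_nonneg hm (div_pos hε hE).le]) le_rfl zero_le_one (by simpa using hk)
      (fun t => hasDerivAt_const _ _) (fun t => hasDerivAt_const _ _) (fun _ => by positivity)
      (fun _ => by simp) (fun _ => by simp) (by rw [he]; exact le_max_left _ _)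
      (by rw [he]; exact le_max_right _ _) θ hθ r hr1 hr2
    refine this.trans ?_
    have h1 : ε / E * (max P Q / (ε / E) + E) = max P Q + ε := by field_simp
    have h2 : 0 ≤ ε / E * Real.exp (k * r) := by positivity
    rw [mul_sub, h1]
    linarith
  · refine le_of_forall_pos_le_add fun ε hε => ?_
    have hd1 : ∀ t, HasDerivAt (fun t => Real.exp (-ν * (t - α)))
        (-ν * Real.exp (-ν * (t - α))) t := fun t => by
      have := (((hasDerivAt_id t).sub_const α).const_mul (-ν)).exp
      simpa [mul_comm] using this
    have hd2 : ∀ t, HasDerivAt (fun t => Real.exp (-ν * (β - t)))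
        (ν * Real.exp (-ν * (β - t))) t := fun t => by
      have := (((hasDerivAt_id t).const_sub β).const_mul (-ν)).exp
      simpa [mul_comm] using this
    -- Adding `δ` keeps `G` positive even if `P = Q = 0`. With `B = 2E` the radial factor lies
    -- between `E` and `2E`, whence the constant 2; the error is at most `2δ(1 + 1) = ε`.
    set δ := ε / 4
    have hδ : 0 < δ := by positivity
    have hP' : 0 < (P + δ) / E := by positivity
    have hQ' : 0 < (Q + δ) / E := by positivity
    have := hcomp (2 * E) ν
      (fun t => (P + δ) / E * Real.exp (-ν * (t - α)) + (Q + δ) / E * Real.exp (-ν * (β - t)))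
      (fun t => (P + δ) / E * (-ν * Real.exp (-ν * (t - α))) +
        (Q + δ) / E * (ν * Real.exp (-ν * (β - t))))
      (fun t => (P + δ) / E * (-ν * (-ν * Real.exp (-ν * (t - α)))) +
        (Q + δ) / E * (ν * (ν * Real.exp (-ν * (β - t)))))
      (by linarith) hν.le hν1 hνD
      (fun t => ((hd1 t).const_mul _).add ((hd2 t).const_mul _))
      (fun t => (((hd1 t).const_mul _).const_mul _).add (((hd2 t).const_mul _).const_mul _))
      (fun t => by positivity)
      (fun t => by
        have h1 : 0 < (P + δ) / E * (ν * Real.exp (-ν * (t - α))) := by positivity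
        have h2 : 0 < (Q + δ) / E * (ν * Real.exp (-ν * (β - t))) := by positivity
        rw [abs_le]
        constructor <;> linarith)
      (fun t => le_of_eq (by ring))
      (by
        have : 0 ≤ (Q + δ) / E * Real.exp (-ν * (β - α)) := by positivity
        have h1 : (P + δ) / E * (2 * E - E) = P + δ := by field_simp; ring
        simp only [sub_self, mul_zero, Real.exp_zero, mul_one]
        rw [add_mul, h1]
        have : 0 ≤ (Q + δ) / E * Real.exp (-ν * (β - α)) * (2 * E - E) :=
          mul_nonneg this (by linarith)
        linarith)
      (by
        have : 0 ≤ (P + δ) / E * Real.exp (-ν * (β - α)) := by positivity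
        have h1 : (Q + δ) / E * (2 * E - E) = Q + δ := by field_simp; ring
        simp only [sub_self, mul_zero, Real.exp_zero, mul_one]
        rw [add_mul, h1]
        have : 0 ≤ (P + δ) / E * Real.exp (-ν * (β - α)) * (2 * E - E) :=
          mul_nonneg this (by linarith)
        linarith) θ hθ r hr1 hr2
    refine this.trans ?_
    set x := Real.exp (-ν * (θ - α))
    set y := Real.exp (-ν * (β - θ))
    have hx : x ≤ 1 := Real.exp_le_one_iff.2
      (mul_nonpos_of_nonpos_of_nonneg (by linarith) (sub_nonneg.2 hθ.1))
    have hy : y ≤ 1 := Real.exp_le_one_iff.2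
      (mul_nonpos_of_nonpos_of_nonneg (by linarith) (sub_nonneg.2 hθ.2))
    have hG0 : 0 ≤ (P + δ) / E * x + (Q + δ) / E * y := by positivity
    calc ((P + δ) / E * x + (Q + δ) / E * y) * (2 * E - Real.exp (k * r))
        ≤ ((P + δ) / E * x + (Q + δ) / E * y) * (2 * E) := by
          gcongr; linarith [Real.exp_pos (k * r)]
      _ = 2 * (P * x + Q * y) + 2 * δ * (x + y) := by field_simp; ring
      _ ≤ 2 * (P * x + Q * y) + 2 * δ * (1 + 1) := by gcongr
      _ = 2 * (P * x + Q * y) + ε := by simp only [δ]; ring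

/-! ### From the two-sided bound to the dichotomy. -/

theorem TwoSidedBound.posPart {θ₀ ν : ℝ} {r₁ r₂ : ℝ → ℝ} {u : Plane → ℝ}
    (h : TwoSidedBound θ₀ r₁ r₂ ν u) : TwoSidedBound θ₀ r₁ r₂ ν fun x => max 0 (u x) := by
  intro α β P Q hα hP hQ hPα hQβ θ hθ x hx
  obtain ⟨h1, h2⟩ := h α β P Q hα hP hQ (fun x hx => (le_max_right _ _).trans (hPα x hx))
    (fun x hx => (le_max_right _ _).trans (hQβ x hx)) θ hθ x hx
  exact ⟨max_le (hP.trans (le_max_left _ _)) h1, max_le (by positivity) h2⟩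

theorem TwoSidedBound.abs {θ₀ ν : ℝ} {r₁ r₂ : ℝ → ℝ} {u : Plane → ℝ}
    (h : TwoSidedBound θ₀ r₁ r₂ ν u) (h' : TwoSidedBound θ₀ r₁ r₂ ν fun x => -u x) :
    TwoSidedBound θ₀ r₁ r₂ ν fun x => |u x| := by
  intro α β P Q hα hP hQ hPα hQβ θ hθ x hx
  obtain ⟨h1, h2⟩ := h α β P Q hα hP hQ (fun x hx => (le_abs_self _).trans (hPα x hx))
    (fun x hx => (le_abs_self _).trans (hQβ x hx)) θ hθ x hx
  obtain ⟨h3, h4⟩ := h' α β P Q hα hP hQ (fun x hx => (neg_le_abs _).trans (hPα x hx))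
    (fun x hx => (neg_le_abs _).trans (hQβ x hx)) θ hθ x hx
  exact ⟨abs_le'.2 ⟨h1, h3⟩, abs_le'.2 ⟨h2, h4⟩⟩

/-- Only the two-sided bound from `θ₀` to an arbitrary later `β` is used. The alternatives exclude
each other because decay sends the maxima to 0 while growth keeps them above `C₁`. -/
theorem TwoSidedBound.xor_decays_grows {θ₀ ν : ℝ} {r₁ r₂ : ℝ → ℝ} {f : Plane → ℝ} (hν : 0 < ν)
    (h : TwoSidedBound θ₀ r₁ r₂ ν f) (hr : ∀ θ, θ₀ ≤ θ → r₁ θ ≤ r₂ θ) (hf0 : ∀ x, 0 ≤ f x)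
    (hf : ContinuousOn f (extDomain θ₀ r₁ r₂)) :
    Xor (Decays θ₀ r₁ r₂ 2 ν f) (Grows θ₀ r₁ r₂ ν f) := by
  set m := crossMax r₁ r₂ f
  have hgr : ∀ θ, θ₀ ≤ θ → IsGreatest (f '' crossSection r₁ r₂ θ) (m θ) := fun θ hθ =>
    isGreatest_crossMax (hr θ hθ) (hf.mono fun x ⟨r, h1, h2, hx⟩ => ⟨r, θ, hθ, h1, h2, hx⟩)
  have hle : ∀ θ, θ₀ ≤ θ → ∀ x ∈ crossSection r₁ r₂ θ, f x ≤ m θ := fun θ hθ x hx =>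
    (hgr θ hθ).2 ⟨x, hx, rfl⟩
  have hm0 : ∀ θ, θ₀ ≤ θ → 0 ≤ m θ := fun θ hθ => by
    obtain ⟨x, -, hx⟩ := (hgr θ hθ).1
    exact hx ▸ hf0 x
  have hb : ∀ θ β, θ₀ ≤ θ → θ ≤ β → m θ ≤ max (m θ₀) (m β) ∧
      m θ ≤ 2 * (m θ₀ * Real.exp (-ν * (θ - θ₀)) + m β * Real.exp (-ν * (β - θ))) := by
    intro θ β hθ hβ
    obtain ⟨x, hx, hxm⟩ := (hgr θ hθ).1
    have := h θ₀ β (m θ₀) (m β) le_rfl (hm0 _ le_rfl) (hm0 _ (hθ.trans hβ)) (hle _ le_rfl)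
      (hle _ (hθ.trans hβ)) θ ⟨hθ, hβ⟩ x hx
    rwa [hxm] at this
  have hlim : ∀ C : ℝ, Tendsto (fun θ => C * Real.exp (-ν * (θ - θ₀))) atTop (𝓝 0) := fun C => by
    have h1 : Tendsto (fun θ => ν * (θ - θ₀)) atTop atTop :=
      (tendsto_atTop_add_const_right _ (-θ₀) tendsto_id).const_mul_atTop hν
    have := (Real.tendsto_exp_neg_atTop_nhds_zero.comp h1).const_mul C
    simpa [Function.comp_def] using this
  by_cases hg : Grows θ₀ r₁ r₂ ν f
  · refine Or.inr ⟨hg, fun hd => ?_⟩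
    obtain ⟨C₁, hC₁, θ₁, hθ₁, hgrow⟩ := hg
    obtain ⟨θ, hθ, hθ'⟩ := (((hlim (2 * m θ₀)).eventually (gt_mem_nhds hC₁)).and
      (eventually_ge_atTop θ₁)).exists
    have h1 := (hgrow θ hθ').trans (hd.2 θ (hθ₁.trans hθ'))
    have h2 : 1 ≤ Real.exp (ν * (θ - θ₀)) :=
      Real.one_le_exp (mul_nonneg hν.le (by linarith))
    have h3 : C₁ ≤ C₁ * Real.exp (ν * (θ - θ₀)) := le_mul_of_one_le_right hC₁.le h2
    exact absurd (h3.trans h1) (not_le.2 hθ)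
  · refine Or.inl ⟨?_, hg⟩
    have hdec : ∀ θ, θ₀ ≤ θ → m θ ≤ 2 * m θ₀ * Real.exp (-ν * (θ - θ₀)) := by
      intro θ hθ
      refine le_of_forall_pos_le_add fun ε hε => ?_
      by_contra! hlt
      -- An excess `ε` over the decay bound at `θ` must come from the term at `β`, so `m β ≥ (ε / 2)
      -- e^{ν(β-θ)}` for every `β ≥ θ`. The constant rebases this exponential at `θ₀`.
      refine hg ⟨ε / 2 * Real.exp (-ν * (θ - θ₀)), by positivity, θ, hθ, fun β hβ => ?_⟩
      have h1 := (hb θ β hθ hβ).2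
      have h2 : ε / 2 ≤ m β * Real.exp (-ν * (β - θ)) := by linarith
      calc ε / 2 * Real.exp (-ν * (θ - θ₀)) * Real.exp (ν * (β - θ₀))
          = ε / 2 * Real.exp (ν * (β - θ)) := by
            rw [mul_assoc, ← Real.exp_add]; congr 2; ring
        _ ≤ m β * Real.exp (-ν * (β - θ)) * Real.exp (ν * (β - θ)) := by gcongr
        _ = m β := by
            rw [mul_assoc, ← Real.exp_add]; simp
    refine ⟨?_, hdec⟩
    rintro x ⟨r, θ, hθ, h1, h2, hx⟩
    refine (hle θ hθ x ⟨r, h1, h2, hx⟩).trans (le_of_forall_pos_le_add fun ε hε => ?_)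
    -- By the decay just shown, the far cross-section contributes at most `ε` to `max (m θ₀) (m β)`.
    obtain ⟨β, hβ, hβ'⟩ := (((hlim (2 * m θ₀)).eventually (gt_mem_nhds hε)).and
      (eventually_ge_atTop θ)).exists
    refine (hb θ β hθ hβ').1.trans (max_le (by linarith) ?_)
    linarith [hdec β (hθ.trans hβ'), hm0 θ₀ le_rfl]

theorem ellipticOp_neg (A : Plane → Matrix (Fin 2) (Fin 2) ℝ) (b : Plane → Plane) (u : Plane → ℝ)
    (x : Plane) : ellipticOp A b (fun y => -u y) x = -ellipticOp A b u x := by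
  have h : ∀ (i : Fin 2) (v : Plane → ℝ),
      partialDeriv i (fun y => -v y) = fun y => -partialDeriv i v y := by
    intro i v
    funext y
    simp only [partialDeriv]
    rw [fderiv_fun_neg]
    rfl
  simp only [ellipticOp, h, mul_neg, Finset.sum_neg_distrib]
  ring

end WindingDomain

theorem theorem4p2
    (θ₀ rstar : ℝ) (r₁ r₂ : ℝ → ℝ)
    (hr₁_cont : ContinuousOn r₁ (Set.Ici θ₀)) (hr₂_cont : ContinuousOn r₂ (Set.Ici θ₀))
    (hr₁_pos : ∀ θ, θ₀ ≤ θ → 0 < r₁ θ) (hr₂_pos : ∀ θ, θ₀ ≤ θ → 0 < r₂ θ)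
    (hr : ∀ θ, θ₀ ≤ θ → r₂ (θ + 2 * Real.pi) < r₁ θ ∧ r₁ θ < r₂ θ)
    (hrstar : 0 < rstar)
    (hr₁_lim : Filter.Tendsto r₁ Filter.atTop (nhds rstar))
    (hr₂_lim : Filter.Tendsto r₂ Filter.atTop (nhds rstar))
    (A : WindingDomain.Plane → Matrix (Fin 2) (Fin 2) ℝ)
    (b : WindingDomain.Plane → WindingDomain.Plane)
    (hA : WindingDomain.IsElliptic (WindingDomain.domain θ₀ r₁ r₂) A)
    (hb : WindingDomain.IsBoundedDrift (WindingDomain.domain θ₀ r₁ r₂) b) :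
    ∃ Cstar ν : ℝ, 0 < Cstar ∧ 0 < ν ∧
      ∀ u : WindingDomain.Plane → ℝ,
        ContDiffOn ℝ 2 u (WindingDomain.domain θ₀ r₁ r₂) →
        ContinuousOn u (WindingDomain.extDomain θ₀ r₁ r₂) →
        (((∀ x ∈ WindingDomain.domain θ₀ r₁ r₂, WindingDomain.ellipticOp A b u x ≤ 0) →
          (∀ x ∈ WindingDomain.lateral θ₀ r₁ r₂, u x ≤ 0) →
          Xor (WindingDomain.Decays θ₀ r₁ r₂ Cstar ν (fun x => max 0 (u x)))
            (WindingDomain.Grows θ₀ r₁ r₂ ν (fun x => max 0 (u x)))) ∧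
        ((∀ x ∈ WindingDomain.domain θ₀ r₁ r₂, WindingDomain.ellipticOp A b u x = 0) →
          (∀ x ∈ WindingDomain.lateral θ₀ r₁ r₂, u x = 0) →
          Xor (WindingDomain.Decays θ₀ r₁ r₂ Cstar ν (fun x => |u x|))
            (WindingDomain.Grows θ₀ r₁ r₂ ν (fun x => |u x|)))) := by
  obtain ⟨ν, hν, h⟩ := WindingDomain.exists_twoSidedBound hr₁_cont hr₂_cont hr₁_pos
    (fun θ hθ => (hr θ hθ).2) hrstar hr₁_lim hr₂_lim hA hb
  refine ⟨2, ν, two_pos, hν, fun u hu2 huc => ⟨fun hL hγ => ?_, fun hL hγ => ?_⟩⟩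
  · exact (h u hu2 huc hL hγ).posPart.xor_decays_grows hν (fun θ hθ => (hr θ hθ).2.le)
      (fun x => le_max_left _ _) (continuousOn_const.sup huc)
  · have hneg := h (fun x => -u x) hu2.neg huc.neg
      (fun x hx => by rw [WindingDomain.ellipticOp_neg, hL x hx, neg_zero])
      (fun x hx => by rw [hγ x hx, neg_zero])
    exact ((h u hu2 huc (fun x hx => (hL x hx).le) fun x hx => (hγ x hx).le).abs
      hneg).xor_decays_grows hν (fun θ hθ => (hr θ hθ).2.le) (fun x => abs_nonneg _) huc.abs
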